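/- **Conventions.** A structure is a relational structure with finitely many relations. For a finite structure $\mathcal D$, let $K_{\mathcal D}$ be the statement: for every structure $\mathcal X$ of the same signature as $\mathcal D$, if every finite substructure of $\mathcal X$ admits a homomorphism to $\mathcal D$, then $\mathcal X$ admits a homomorphism to $\mathcal D$. An $n$-ary polymorphism of $\mathcal D$ is a homomorphism $\phi:\mathcal D^n\to\mathcal D$ (categorical power); it is cyclic if $n\ge 2$ and $\phi(x_0,x_1,\dots,x_{n-1})=\phi(x_1,\dots,x_{n-1},x_0)$ for all $x_0,\dots,x_{n-1}\in D$. Let $(*)_{\mathcal D}$ denote that $\mathcal D$ has a cyclic polymorphism of every prime arity $p>|D|$. $K_3$ is the complete graph on three vertices, and ZFA is Zermelo–Fraenkel set theory (without choice) with a set of atoms. **The model.** Let $\Gamma=\bigoplus_{p\text{ prime}}\mathbb Z_p$ with standard generators $\gamma_p$. Let the set of atoms be $Y=\bigsqcup_{p\text{ prime}}\{p\}\times\mathbb Z_p$, on which $\Gamma$ acts by $\gamma_p\cdot(p,j)=(p,j+1)$ and $\gamma_p\cdot(q,j)=(q,j)$ for $q\neq p$. Let $\mathcal F$ be the filter of subgroups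 of $\Gamma$ generated by the subgroups $\langle\gamma_p : p\ge n\rangle$, $n\in\mathbb N$. Extend the action to the cumulative hierarchy over $Y$ by $\gamma\cdot x=\{\gamma\cdot y:y\in x\}$, and let $U$ be the class of hereditarily $\mathcal F$-symmetric elements of the hierarchy: $x\in U$ if and only if the stabilizer of $x$ belongs to $\mathcal F$ and every element of $x$ belongs to $U$. **Theorem.** The permutation model $U$ is a model of ZFA. For every finite structure $\mathcal D$ satisfying $(*)_{\mathcal D}$, the statement $K_{\mathcal D}$ holds in $U$. The statement $K_{K_3}$ fails in $U$. -/

import Mathlib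

universe u v w

namespace SetsWithAtoms

/-! ## Models of set theory with atoms

The language has the membership relation and the predicate "is an atom". All notions below are
interpreted inside a structure `M` for this language: every quantifier ranges over `M`. -/

/-- Relation symbols of the language of set theory with atoms. -/
inductive AtomRel : ℕ → Type
  | isAtom : AtomRel 1
  | mem : AtomRel 2

/-- The first-order language of set theory with atoms. -/
def atomLang : FirstOrder.Language.{0, 0} := ⟨fun _ => Empty, AtomRel⟩

/-- A structure for the language of set theory with atoms. -/
class AtomStructure (M : Type u) where
  mem : M → M → Prop
  isAtom : M → Prop

open AtomStructure

instance atomLangStructure (M : Type u) [AtomStructure M] : atomLang.Structure M where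
  funMap := fun f _ => Empty.elim f
  RelMap := fun {_} r =>
    match r with
    | AtomRel.isAtom => fun x => isAtom (x 0)
    | AtomRel.mem => fun x => mem (x 0) (x 1)

section Internal

variable {M : Type u} [AtomStructure M]

/-- A set of `M` is an object that is not an atom. -/
def IsSet (x : M) : Prop := ¬ isAtom x

def IsEmptySet (x : M) : Prop := IsSet x ∧ ∀ y, ¬ mem y x

def Subset (x y : M) : Prop := ∀ z, mem z x → mem z y

/-- `z = {x, y}`. -/
def IsUnorderedPair (z x y : M) : Prop := IsSet z ∧ ∀ t, mem t z ↔ t = x ∨ t = y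

/-- `p = (x, y) = {{x}, {x, y}}`. -/
def IsPair (p x y : M) : Prop :=
  IsSet p ∧ ∀ z, mem z p ↔ IsUnorderedPair z x x ∨ IsUnorderedPair z x y

/-- `y = x ∪ {x}`. -/
def IsSucc (y x : M) : Prop := IsSet y ∧ ∀ z, mem z y ↔ mem z x ∨ z = x

def IsInductive (I : M) : Prop :=
  IsSet I ∧ (∃ z, IsEmptySet z ∧ mem z I) ∧ ∀ x, mem x I → ∃ y, IsSucc y x ∧ mem y I

/-- `n` is a natural number in the sense of `M`, i.e. an element of `ω`. -/
def IsNatural (n : M) : Prop := ∀ I, IsInductive I → mem n I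

/-- `(a, b) ∈ f`. -/
def Related (f a b : M) : Prop := ∃ p, mem p f ∧ IsPair p a b

/-- `f` is a function from `x` to `y`. -/
def IsFunction (f x y : M) : Prop :=
  IsSet f ∧ (∀ p, mem p f → ∃ a b, mem a x ∧ mem b y ∧ IsPair p a b) ∧
    ∀ a, mem a x → ∃! b, Related f a b

/-- `f` is a bijection from `x` to `y`. -/
def IsBijection (f x y : M) : Prop :=
  IsFunction f x y ∧ ∀ b, mem b y → ∃! a, Related f a b

/-- `x` is a finite set in the sense of `M`. -/
def IsFiniteSet (x : M) : Prop := IsSet x ∧ ∃ n f, IsNatural n ∧ IsBijection f x n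

/-- `t` is the tuple `(v 0, v 1, …, v (n - 1))`, coded as `(v 0, (v 1, (…, (v (n - 1), ∅))))`. -/
def IsTuple : {n : ℕ} → (Fin n → M) → M → Prop
  | 0, _, t => IsEmptySet t
  | _ + 1, v, t => ∃ s, IsTuple (fun i => v i.succ) s ∧ IsPair t (v 0) s

variable (M) in
/-- The axioms of ZFA. The schemas of separation and replacement range over the classes (class
functions) that are first-order definable over `M` with parameters from `M`. -/
structure IsZFAModel : Prop where
  atom_no_elements : ∀ a x : M, isAtom a → ¬ mem x a
  set_of_atoms : ∃ A : M, IsSet A ∧ ∀ x, mem x A ↔ isAtom x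
  extensionality : ∀ x y : M, IsSet x → IsSet y → (∀ z, mem z x ↔ mem z y) → x = y
  pairing : ∀ x y : M, ∃ z, IsUnorderedPair z x y
  union : ∀ x : M, ∃ y, IsSet y ∧ ∀ z, mem z y ↔ ∃ t, mem t x ∧ mem z t
  powerset : ∀ x : M, ∃ y, IsSet y ∧ ∀ z, mem z y ↔ IsSet z ∧ Subset z x
  infinity : ∃ I : M, IsInductive I
  foundation : ∀ x : M, (∃ y, mem y x) → ∃ y, mem y x ∧ ∀ z, mem z y → ¬ mem z x
  separation : ∀ P : M → Prop, (Set.univ : Set M).Definable₁ atomLang {x | P x} →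
    ∀ x : M, ∃ y, IsSet y ∧ ∀ z, mem z y ↔ mem z x ∧ P z
  replacement : ∀ P : M → M → Prop, (Set.univ : Set M).Definable₂ atomLang {p | P p.1 p.2} →
    (∀ x y z, P x y → P x z → y = z) →
    ∀ x : M, ∃ y, IsSet y ∧ ∀ z, mem z y ↔ ∃ t, mem t x ∧ P t z

variable (M) in
/-- A relational structure of signature `L` that is an element of `M`: a set of `M` together with,
for each relation symbol of arity `n`, a set of `M` consisting of `n`-tuples of its elements. (The
signature is finite in all uses, hence the finite family of these sets is an element of `M`.) -/
structure InternalStructure (L : FirstOrder.Language.{v, w}) where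
  carrier : M
  isSet_carrier : IsSet carrier
  rel : ∀ {n : ℕ}, L.Relations n → M
  isSet_rel : ∀ {n : ℕ} (R : L.Relations n), IsSet (rel R)
  rel_tuples : ∀ {n : ℕ} (R : L.Relations n) (t : M), mem t (rel R) →
    ∃ x : Fin n → M, (∀ i, mem (x i) carrier) ∧ IsTuple x t

namespace InternalStructure

variable {L : FirstOrder.Language.{v, w}}

/-- The tuple `x` of elements of `M` belongs to the relation `R` of `X`. -/
def Holds (X : InternalStructure M L) {n : ℕ} (R : L.Relations n) (x : Fin n → M) : Prop :=
  ∃ t, IsTuple x t ∧ mem t (X.rel R)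

/-- `Y` is a substructure of `X`: a subset with the induced relations. -/
def IsSubstructure (Y X : InternalStructure M L) : Prop :=
  Subset Y.carrier X.carrier ∧
    ∀ {n : ℕ} (R : L.Relations n) (x : Fin n → M), (∀ i, mem (x i) Y.carrier) →
      (Y.Holds R x ↔ X.Holds R x)

/-- The element `h` of `M` is a homomorphism from `X` to `Y`. -/
def IsHom (X Y : InternalStructure M L) (h : M) : Prop :=
  IsFunction h X.carrier Y.carrier ∧
    ∀ {n : ℕ} (R : L.Relations n) (x y : Fin n → M), X.Holds R x →
      (∀ i, Related h (x i) (y i)) → Y.Holds R y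

/-- `X` is, viewed from outside of `M`, isomorphic to the structure `D`. -/
def IsCopyOf (X : InternalStructure M L) (D : Type*) [L.Structure D] : Prop :=
  ∃ e : D → M, Function.Injective e ∧ (∀ x, mem x X.carrier ↔ ∃ d, e d = x) ∧
    ∀ {n : ℕ} (R : L.Relations n) (d : Fin n → D),
      X.Holds R (fun i => e (d i)) ↔ FirstOrder.Language.Structure.RelMap R d

/-- The compactness principle for the template `T`, in the sense of `M`: for every instance `X`,
if every finite substructure of `X` admits a homomorphism to `T`, then so does `X`. -/
def Compactness (T : InternalStructure M L) : Prop :=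
  ∀ X : InternalStructure M L,
    (∀ Y : InternalStructure M L, Y.IsSubstructure X → IsFiniteSet Y.carrier →
      ∃ h, Y.IsHom T h) →
    ∃ h, X.IsHom T h

end InternalStructure

end Internal

/-- The statement `K_D` holds in `M`. The finite structure `D` is represented in `M` by any
isomorphic copy of it that lies in `M`. -/
def HoldsK (M : Type u) [AtomStructure M] (L : FirstOrder.Language.{v, w}) (D : Type*)
    [L.Structure D] : Prop :=
  ∀ T : InternalStructure M L, T.IsCopyOf D → T.Compactness

/-! ## Cyclic polymorphisms -/

/-- `φ` is an `n`-ary polymorphism of `D`, i.e. a homomorphism from the categorical power `D ^ n`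
to `D`. -/
def IsPolymorphism (L : FirstOrder.Language.{v, w}) {D : Type*} [L.Structure D] {n : ℕ}
    (φ : (Fin n → D) → D) : Prop :=
  ∀ {k : ℕ} (R : L.Relations k) (x : Fin k → Fin n → D),
    (∀ j, FirstOrder.Language.Structure.RelMap R (fun i => x i j)) →
      FirstOrder.Language.Structure.RelMap R (fun i => φ (x i))

/-- `φ (x 0, x 1, …, x (n - 1)) = φ (x 1, …, x (n - 1), x 0)`. -/
def IsCyclic {D : Type*} {n : ℕ} (φ : (Fin n → D) → D) : Prop :=
  2 ≤ n ∧ ∀ x : Fin n → D, φ x = φ (fun i => x (finRotate n i))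

/-- The property `(*)` of a finite structure `D`: it has a cyclic polymorphism of every prime arity
`p > |D|`. -/
def Star (L : FirstOrder.Language.{v, w}) (D : Type*) [L.Structure D] : Prop :=
  ∀ p : ℕ, p.Prime → Nat.card D < p →
    ∃ φ : (Fin p → D) → D, IsPolymorphism L φ ∧ IsCyclic φ

/-! ## The cumulative hierarchy over a set of atoms -/

/-- Codes for the elements of the cumulative hierarchy over the set of atoms `A`. -/
inductive PreUniv (A : Type u) : Type (u + 1)
  | atom (a : A) : PreUniv A
  | mk (ι : Type u) (f : ι → PreUniv A) : PreUniv A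

namespace PreUniv

variable {A : Type u}

/-- Two codes denote the same object: the same atom, or sets with the same elements. -/
def Equiv : PreUniv A → PreUniv A → Prop
  | atom a, atom b => a = b
  | mk _ f, mk _ g => (∀ i, ∃ j, Equiv (f i) (g j)) ∧ ∀ j, ∃ i, Equiv (f i) (g j)
  | atom _, mk _ _ => False
  | mk _ _, atom _ => False

theorem Equiv.refl : ∀ x : PreUniv A, Equiv x x
  | atom _ => rfl
  | mk _ f => ⟨fun i => ⟨i, Equiv.refl (f i)⟩, fun i => ⟨i, Equiv.refl (f i)⟩⟩

theorem Equiv.symm : ∀ {x y : PreUniv A}, Equiv x y → Equiv y x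
  | atom _, atom _, h => Eq.symm h
  | mk _ _, mk _ _, ⟨h₁, h₂⟩ =>
    ⟨fun j => (h₂ j).imp fun _ h => h.symm, fun i => (h₁ i).imp fun _ h => h.symm⟩
  | atom _, mk _ _, h => h.elim
  | mk _ _, atom _, h => h.elim

theorem Equiv.trans : ∀ {x y z : PreUniv A}, Equiv x y → Equiv y z → Equiv x z
  | atom _, atom _, atom _, h, k => Eq.trans h k
  | mk _ _, mk _ _, mk _ _, ⟨h₁, h₂⟩, ⟨k₁, k₂⟩ =>
    ⟨fun i => let ⟨j, hj⟩ := h₁ i; let ⟨l, hl⟩ := k₁ j; ⟨l, hj.trans hl⟩,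
      fun l => let ⟨j, hj⟩ := k₂ l; let ⟨i, hi⟩ := h₂ j; ⟨i, hi.trans hj⟩⟩
  | atom _, mk _ _, _, h, _ => h.elim
  | mk _ _, atom _, _, h, _ => h.elim
  | _, atom _, mk _ _, _, k => k.elim
  | _, mk _ _, atom _, _, k => k.elim

instance setoid (A : Type u) : Setoid (PreUniv A) :=
  ⟨Equiv, Equiv.refl, Equiv.symm, Equiv.trans⟩

/-- The object denoted by `x` is an element of the object denoted by the second argument. -/
def Mem (x : PreUniv A) : PreUniv A → Prop
  | atom _ => False
  | mk _ f => ∃ i, Equiv x (f i)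

theorem Mem.congr {x x' y y' : PreUniv A} (hx : Equiv x x') (hy : Equiv y y') :
    Mem x y ↔ Mem x' y' := by
  match y, y', hy with
  | atom _, atom _, _ => exact Iff.rfl
  | mk _ _, mk _ _, ⟨h₁, h₂⟩ =>
    exact ⟨fun ⟨i, hi⟩ => let ⟨j, hj⟩ := h₁ i; ⟨j, (hx.symm.trans hi).trans hj⟩,
      fun ⟨j, hj⟩ => let ⟨i, hi⟩ := h₂ j; ⟨i, (hx.trans hj).trans hi.symm⟩⟩

variable {Γ : Type v} [Group Γ] [MulAction Γ A]

/-- The action on the atoms, extended to the hierarchy by `γ • x = {γ • y : y ∈ x}`. -/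
def act (γ : Γ) : PreUniv A → PreUniv A
  | atom a => atom (γ • a)
  | mk ι f => mk ι (fun i => act γ (f i))

theorem act_equiv (γ : Γ) : ∀ {x y : PreUniv A}, Equiv x y → Equiv (act γ x) (act γ y)
  | atom _, atom _, h => congrArg (γ • ·) h
  | mk _ _, mk _ _, ⟨h₁, h₂⟩ =>
    ⟨fun i => (h₁ i).imp fun _ h => act_equiv γ h, fun j => (h₂ j).imp fun _ h => act_equiv γ h⟩
  | atom _, mk _ _, h => h.elim
  | mk _ _, atom _, h => h.elim

theorem act_one : ∀ x : PreUniv A, act (1 : Γ) x = x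
  | atom a => congrArg atom (one_smul Γ a)
  | mk ι f => congrArg (mk ι) (funext fun i => act_one (f i))

theorem act_mul (γ δ : Γ) : ∀ x : PreUniv A, act (γ * δ) x = act γ (act δ x)
  | atom a => congrArg atom (mul_smul γ δ a)
  | mk ι f => congrArg (mk ι) (funext fun i => act_mul γ δ (f i))

end PreUniv

/-- The cumulative hierarchy of sets over the set of atoms `A`. -/
def Univ (A : Type u) : Type (u + 1) := Quotient (PreUniv.setoid A)

namespace Univ

variable {A : Type u}

def atom (a : A) : Univ A := Quotient.mk _ (PreUniv.atom a)

def Mem (x y : Univ A) : Prop :=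
  Quotient.liftOn₂ x y PreUniv.Mem fun _ _ _ _ hx hy => propext (PreUniv.Mem.congr hx hy)

instance (Γ : Type v) [Group Γ] [MulAction Γ A] : MulAction Γ (Univ A) where
  smul γ := Quotient.map (PreUniv.act γ) fun _ _ h => PreUniv.act_equiv γ h
  one_smul x := Quotient.inductionOn x fun a => congrArg (Quotient.mk _) (PreUniv.act_one a)
  mul_smul γ δ x :=
    Quotient.inductionOn x fun a => congrArg (Quotient.mk _) (PreUniv.act_mul γ δ a)

end Univ

/-! ## Permutation models -/

/-- A filter of subgroups of `Γ`. -/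
structure SubgroupFilter (Γ : Type v) [Group Γ] where
  sets : Set (Subgroup Γ)
  bot_notMem : ⊥ ∉ sets
  top_mem : ⊤ ∈ sets
  inf_mem : ∀ {Δ Δ' : Subgroup Γ}, Δ ∈ sets → Δ' ∈ sets → Δ ⊓ Δ' ∈ sets
  mem_of_le : ∀ {Δ Δ' : Subgroup Γ}, Δ ∈ sets → Δ ≤ Δ' → Δ' ∈ sets
  conj_mem : ∀ {Δ : Subgroup Γ} (γ : Γ), Δ ∈ sets → Δ.map (MulAut.conj γ).toMonoidHom ∈ sets

/-- The hereditarily symmetric elements of the hierarchy: the stabilizer of `x` is in the filter,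
and all elements of `x` are hereditarily symmetric. -/
inductive HereditarilySymmetric {A : Type u} {Γ : Type v} [Group Γ] [MulAction Γ A]
    (F : SubgroupFilter Γ) : Univ A → Prop
  | intro (x : Univ A) (symm : MulAction.stabilizer Γ x ∈ F.sets)
      (elements : ∀ y, Univ.Mem y x → HereditarilySymmetric F y) : HereditarilySymmetric F x

/-- The permutation model given by the set of atoms `A`, a group `Γ` acting on it, and a filter of
subgroups of `Γ`. -/
def PermutationModel (A : Type u) {Γ : Type v} [Group Γ] [MulAction Γ A] (F : SubgroupFilter Γ) :
    Type (u + 1) :=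
  {x : Univ A // HereditarilySymmetric F x}

instance (A : Type u) {Γ : Type v} [Group Γ] [MulAction Γ A] (F : SubgroupFilter Γ) :
    AtomStructure (PermutationModel A F) where
  mem x y := Univ.Mem x.1 y.1
  isAtom x := ∃ a : A, x.1 = Univ.atom a

/-! ## The group `⨁ₚ ℤ/p` acting on disjoint cycles -/

open DirectSum in
/-- The direct sum of the groups `ℤ/p` over all primes `p`, written multiplicatively. -/
abbrev PrimeGroup : Type := Multiplicative (⨁ p : Nat.Primes, ZMod p)

/-- The standard generators of the direct sum. -/
def generator (p : Nat.Primes) : PrimeGroup :=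
  Multiplicative.ofAdd (DirectSum.of (fun q : Nat.Primes => ZMod q) p 1)

/-- The disjoint union of cycles of length `p`, one for each prime `p`. -/
structure Cycles : Type where
  prime : Nat.Primes
  pos : ZMod prime

/-- The `p`-th summand rotates the cycle of length `p` and fixes the other cycles. -/
instance : MulAction PrimeGroup Cycles where
  smul g y := ⟨y.prime, y.pos + (Multiplicative.toAdd g) y.prime⟩
  one_smul y := congrArg (Cycles.mk y.prime) (add_zero y.pos)
  mul_smul g h y := congrArg (Cycles.mk y.prime) (by
    change y.pos + ((Multiplicative.toAdd g) y.prime + (Multiplicative.toAdd h) y.prime)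
      = y.pos + (Multiplicative.toAdd h) y.prime + (Multiplicative.toAdd g) y.prime
    abel)

/-- The subgroup generated by the generators of order at least `n`. -/
def tailSubgroup (n : ℕ) : Subgroup PrimeGroup :=
  Subgroup.closure {g | ∃ p : Nat.Primes, n ≤ (p : ℕ) ∧ g = generator p}

theorem tailSubgroup_anti {m n : ℕ} (h : m ≤ n) : tailSubgroup n ≤ tailSubgroup m :=
  Subgroup.closure_mono fun _ ⟨p, hp, hg⟩ => ⟨p, h.trans hp, hg⟩

theorem generator_ne_one (p : Nat.Primes) : generator p ≠ 1 := by
  intro h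
  have h₁ : DirectSum.of (fun q : Nat.Primes => ZMod q) p 1 = 0 := Multiplicative.ofAdd.injective h
  have h₂ := DirectSum.of_injective (β := fun q : Nat.Primes => ZMod q) p
    (h₁.trans (map_zero _).symm)
  have : Fact (1 < (p : ℕ)) := ⟨p.2.one_lt⟩
  exact one_ne_zero h₂

/-- The filter generated by the subgroups `tailSubgroup n`. -/
def primeFilter : SubgroupFilter PrimeGroup where
  sets := {Δ | ∃ n, tailSubgroup n ≤ Δ}
  bot_notMem := by
    rintro ⟨n, hn⟩
    obtain ⟨p, hnp, hp⟩ := Nat.exists_infinite_primes n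
    exact generator_ne_one ⟨p, hp⟩
      ((Subgroup.mem_bot).1 (hn (Subgroup.subset_closure ⟨⟨p, hp⟩, hnp, rfl⟩)))
  top_mem := ⟨0, le_top⟩
  inf_mem := fun ⟨m, hm⟩ ⟨n, hn⟩ =>
    ⟨max m n, le_inf ((tailSubgroup_anti (le_max_left m n)).trans hm)
      ((tailSubgroup_anti (le_max_right m n)).trans hn)⟩
  mem_of_le := fun ⟨n, hn⟩ h => ⟨n, hn.trans h⟩
  conj_mem := fun γ ⟨n, hn⟩ => ⟨n, fun g hg => ⟨g, hn hg, by
    simp [MulAut.conj_apply, mul_comm γ g]⟩⟩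

/-- The permutation model given by the cycles of prime length, the group `⨁ₚ ℤ/p` and the filter
generated by the subgroups `⟨γ_p : p ≥ n⟩`. -/
abbrev PrimeModel : Type 1 := PermutationModel Cycles primeFilter

/-- The complete graph on three vertices as a relational structure. -/
instance completeGraphThree : FirstOrder.Language.graph.Structure (Fin 3) :=
  (⊤ : SimpleGraph (Fin 3)).structure

end SetsWithAtoms

/-!
# Compactness principles in a permutation model with cycles of prime length

A small class of elements of a permutation model is a set of the model exactly when a subgroup of
the filter stabilizes it (`exists_set`). The axioms of ZFA follow, since the group acts on the model
by automorphisms: a class that is definable with parameters is stable under all group elements that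
fix its finitely many parameters (`eventually_smul_mem_of_definable`). Finite sets are symmetric and
`ω` is the true one, so finiteness in the model is finiteness from outside (`isFiniteSet_iff`), and
a function or a structure given from outside lies in the model as soon as a subgroup of the filter
respects it (`exists_isFunction`, `exists_internalStructure`).

Let `D` have cyclic polymorphisms of all prime arities above `|D|`, and let `X` be an instance all
of whose finite substructures map to `D`. For large `n`, the generators `γ_p` with `p ≥ n` are
commuting automorphisms of `X`, the order of `γ_p` being `p > |D|`. Compactness outside of the model
gives a homomorphism `h : X → D`. Replacing it by `x ↦ φ (h x, h (γ_p x), …, h (γ_p ^ (p - 1) x))`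
with `φ` cyclic makes it invariant under `γ_p` and keeps the invariances obtained before
(`MapsRel.exists_invariant`). So there are homomorphisms invariant under any finite number of these
generators, and by compactness again there is one invariant under all of them
(`exists_invariant_mapsRel`). It is symmetric, hence in the model.

For `K₃`, take the graph on the atoms that is the disjoint union of cycles of length `p`, with `γ_p`
rotating the `p`-cycle. It is 3-colourable from outside, hence its finite subgraphs are 3-colourable
in the model. But a symmetric colouring is invariant under `γ_p` for all large `p`, so it gives the
same colour to the adjacent vertices `y` and `γ_p y` (`not_holdsK_completeGraphThree`).
-/

universe w'

namespace SetsWithAtoms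

open Filter AtomStructure
open FirstOrder.Language (Structure)

/-! ### The cumulative hierarchy -/

namespace Univ

variable {A : Type u}

theorem ext {x y : Univ A} (hx : ∀ a, x ≠ atom a) (hy : ∀ a, y ≠ atom a)
    (h : ∀ z, Mem z x ↔ Mem z y) : x = y := by
  induction x, y using Quotient.inductionOn₂ with
  | _ x y =>
    match x, y with
    | .atom a, _ => exact absurd rfl (hx a)
    | _, .atom a => exact absurd rfl (hy a)
    | .mk ι f, .mk κ g =>
      refine Quotient.sound ⟨fun i => (h (Quotient.mk _ (f i))).1 ⟨i, .refl _⟩, fun j => ?_⟩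
      obtain ⟨i, hi⟩ := (h (Quotient.mk _ (g j))).2 ⟨j, .refl _⟩
      exact ⟨i, hi.symm⟩

theorem not_mem_atom (x : Univ A) (a : A) : ¬ Mem x (atom a) := by
  induction x using Quotient.inductionOn with
  | _ x => exact id

theorem atom_injective : Function.Injective (atom : A → Univ A) :=
  fun _ _ h => Quotient.exact h

theorem small_elements (x : Univ A) : Small.{u} {y | Mem y x} := by
  induction x using Quotient.inductionOn with
  | _ x =>
    match x with
    | .atom a =>
      exact small_subset (s := ∅) fun y hy => not_mem_atom y a hy
    | .mk ι f =>
      refine small_subset (s := Set.range fun i => (Quotient.mk _ (f i) : Univ A)) ?_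
      intro y hy
      induction y using Quotient.inductionOn with
      | _ y =>
        obtain ⟨i, hi⟩ := hy
        exact ⟨i, Quotient.sound hi.symm⟩

/-- The members of the hierarchy other than atoms are the small sets of members. -/
theorem exists_set (s : Set (Univ A)) [Small.{u} s] :
    ∃ x : Univ A, (∀ a, x ≠ atom a) ∧ ∀ z, Mem z x ↔ z ∈ s := by
  let g : Shrink.{u} s → Univ A := fun i => (equivShrink s).symm i
  refine ⟨Quotient.mk _ (PreUniv.mk (Shrink.{u} s) fun i => (g i).out), ?_, fun z => ?_⟩
  · exact fun a h => Quotient.exact h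
  · have key : Mem z (Quotient.mk _ (PreUniv.mk (Shrink.{u} s) fun i => (g i).out)) ↔
        ∃ i, z = g i := by
      induction z using Quotient.inductionOn with
      | _ z =>
        refine exists_congr fun i => ?_
        conv_rhs => rw [← Quotient.out_eq (g i)]
        exact (Quotient.eq (r := PreUniv.setoid A)).symm
    rw [key]
    constructor
    · rintro ⟨i, rfl⟩
      exact ((equivShrink s).symm i).2
    · exact fun hz => ⟨equivShrink s ⟨z, hz⟩, by simp [g]⟩

theorem mem_wellFounded : WellFounded (Mem : Univ A → Univ A → Prop) := by
  have key : ∀ (p : PreUniv A) (y : Univ A), y = Quotient.mk _ p → Acc Mem y := by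
    intro p
    induction p with
    | atom a => exact fun y hy => ⟨_, fun z hz => by subst hy; exact absurd hz (not_mem_atom z a)⟩
    | mk ι f ih =>
      rintro y rfl
      refine ⟨_, fun z hz => ?_⟩
      induction z using Quotient.inductionOn with
      | _ z =>
        obtain ⟨i, hi⟩ := hz
        exact ih i _ (Quotient.sound hi)
  refine ⟨fun x => ?_⟩
  induction x using Quotient.inductionOn with
  | _ x => exact key x _ rfl

variable {Γ : Type v} [Group Γ] [MulAction Γ A]

theorem smul_atom (γ : Γ) (a : A) : γ • (atom a : Univ A) = atom (γ • a) := rfl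

theorem smul_ne_atom {γ : Γ} {x : Univ A} (hx : ∀ a, x ≠ atom a) (a : A) : γ • x ≠ atom a := by
  intro h
  exact hx (γ⁻¹ • a) (by rw [← smul_atom, ← h, inv_smul_smul])

theorem mem_smul_of_mem (γ : Γ) {x y : Univ A} (h : Mem x y) : Mem (γ • x) (γ • y) := by
  induction x, y using Quotient.inductionOn₂ with
  | _ x y =>
    match y with
    | .atom a => exact h
    | .mk ι f =>
      obtain ⟨i, hi⟩ := h
      exact ⟨i, PreUniv.act_equiv γ hi⟩

theorem mem_smul_smul_iff (γ : Γ) {x y : Univ A} : Mem (γ • x) (γ • y) ↔ Mem x y :=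
  ⟨fun h => by simpa using mem_smul_of_mem γ⁻¹ h, mem_smul_of_mem γ⟩

end Univ

/-! ### Symmetric classes in a permutation model -/

section Model

variable {A : Type u} {Γ : Type v} [Group Γ]

/-- The filter of subsets of `Γ` that contain a subgroup of `F`: the neighbourhoods of `1` for the
group topology that `F` defines. `∀ᶠ γ in F.nhdsOne, p γ` says that `p` holds on a subgroup of
`F`. -/
def SubgroupFilter.nhdsOne (F : SubgroupFilter Γ) : Filter Γ where
  sets := {s | ∃ Δ ∈ F.sets, (Δ : Set Γ) ⊆ s}
  univ_sets := ⟨⊤, F.top_mem, Set.subset_univ _⟩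
  sets_of_superset := fun ⟨Δ, h, hs⟩ hst => ⟨Δ, h, hs.trans hst⟩
  inter_sets := fun ⟨Δ, h, hs⟩ ⟨Δ', h', hs'⟩ =>
    ⟨Δ ⊓ Δ', F.inf_mem h h', fun _ hγ => ⟨hs hγ.1, hs' hγ.2⟩⟩

variable {F : SubgroupFilter Γ}

theorem SubgroupFilter.eventually_iff {p : Γ → Prop} :
    (∀ᶠ γ in F.nhdsOne, p γ) ↔ ∃ Δ ∈ F.sets, ∀ γ ∈ Δ, p γ := Iff.rfl

variable [MulAction Γ A]

theorem HereditarilySymmetric.stabilizer_mem {x : Univ A} (h : HereditarilySymmetric F x) :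
    MulAction.stabilizer Γ x ∈ F.sets := by
  cases h; assumption

theorem HereditarilySymmetric.of_mem {x y : Univ A} (h : HereditarilySymmetric F x)
    (hy : Univ.Mem y x) : HereditarilySymmetric F y := by
  cases h with
  | intro _ _ h => exact h y hy

theorem HereditarilySymmetric.smul {x : Univ A} (h : HereditarilySymmetric F x) (γ : Γ) :
    HereditarilySymmetric F (γ • x) := by
  induction h with
  | intro x symm _ ih =>
    refine .intro _ ?_ fun y hy => ?_
    · rw [MulAction.stabilizer_smul_eq_stabilizer_map_conj]
      exact F.conj_mem γ symm
    · have := ih (γ⁻¹ • y) (by simpa using Univ.mem_smul_of_mem γ⁻¹ hy)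
      rwa [smul_inv_smul] at this

/-- The group acts on the permutation model by automorphisms. -/
instance : MulAction Γ (PermutationModel A F) where
  smul γ x := ⟨γ • x.1, x.2.smul γ⟩
  one_smul x := Subtype.ext (one_smul Γ x.1)
  mul_smul γ δ x := Subtype.ext (mul_smul γ δ x.1)

theorem eventually_smul_eq (x : PermutationModel A F) : ∀ᶠ γ in F.nhdsOne, γ • x = x :=
  ⟨_, x.2.stabilizer_mem, fun _ hγ => Subtype.ext hγ⟩

theorem mem_smul_smul_iff (γ : Γ) {x y : PermutationModel A F} :
    mem (γ • x) (γ • y) ↔ mem x y := Univ.mem_smul_smul_iff γ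

theorem mem_smul_iff (γ : Γ) {x y : PermutationModel A F} :
    mem x (γ • y) ↔ mem (γ⁻¹ • x) y := by
  rw [← mem_smul_smul_iff γ (x := γ⁻¹ • x), smul_inv_smul]

theorem isAtom_smul_iff (γ : Γ) {x : PermutationModel A F} : isAtom (γ • x) ↔ isAtom x := by
  constructor
  · rintro ⟨a, ha⟩
    refine ⟨γ⁻¹ • a, ?_⟩
    rw [← Univ.smul_atom, ← ha]
    exact (inv_smul_smul γ x.1).symm
  · rintro ⟨a, ha⟩
    exact ⟨γ • a, congrArg (γ • ·) ha⟩

theorem isSet_smul_iff (γ : Γ) {x : PermutationModel A F} : IsSet (γ • x) ↔ IsSet x :=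
  not_congr (isAtom_smul_iff γ)

theorem isSet_iff_forall_ne {x : PermutationModel A F} : IsSet x ↔ ∀ a, x.1 ≠ Univ.atom a :=
  not_exists

theorem IsSet.of_mem {x y : PermutationModel A F} (h : mem x y) : IsSet y := by
  rintro ⟨a, ha⟩
  exact Univ.not_mem_atom _ a (ha ▸ h : Univ.Mem x.1 (Univ.atom a))

theorem IsSet.ext {x y : PermutationModel A F} (hx : IsSet x) (hy : IsSet y)
    (h : ∀ z, mem z x ↔ mem z y) : x = y :=
  Subtype.ext <| Univ.ext (isSet_iff_forall_ne.1 hx) (isSet_iff_forall_ne.1 hy) fun z =>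
    ⟨fun hz => (h ⟨z, x.2.of_mem hz⟩).1 hz, fun hz => (h ⟨z, y.2.of_mem hz⟩).2 hz⟩

theorem small_setOf_mem (x : PermutationModel A F) : Small.{u} {y | mem y x} := by
  have := Univ.small_elements x.1
  exact small_of_injective (β := {y | Univ.Mem y x.1}) (f := fun y => ⟨y.1.1, y.2⟩)
    fun y z h => Subtype.ext (Subtype.ext (Subtype.mk.inj h))

theorem small_of_forall_mem {s : Set (PermutationModel A F)} {x : PermutationModel A F}
    (h : ∀ y ∈ s, mem y x) : Small.{u} s :=
  have := small_setOf_mem x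
  small_subset (s := {y | mem y x}) h

/-- Comprehension in a permutation model: a small class that is stable under a subgroup of the
filter is a set of the model. -/
theorem exists_set (s : Set (PermutationModel A F)) [Small.{u} s]
    (hs : ∀ᶠ γ in F.nhdsOne, ∀ x ∈ s, γ • x ∈ s) :
    ∃ x : PermutationModel A F, IsSet x ∧ ∀ z, mem z x ↔ z ∈ s := by
  obtain ⟨x, hx, hxs⟩ := Univ.exists_set ((fun y : PermutationModel A F => y.1) '' s)
  obtain ⟨Δ, hΔ, hΔs⟩ := SubgroupFilter.eventually_iff.1 hs
  have hfix : ∀ γ ∈ Δ, ∀ z, Univ.Mem z x → Univ.Mem (γ • z) x := by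
    intro γ hγ z hz
    obtain ⟨y, hy, rfl⟩ := (hxs z).1 hz
    exact (hxs _).2 ⟨γ • y, hΔs γ hγ y hy, rfl⟩
  have hsymm : HereditarilySymmetric F x := by
    refine .intro x (F.mem_of_le hΔ fun γ hγ => ?_) fun y hy => ?_
    · refine Univ.ext (Univ.smul_ne_atom hx) hx fun z => ⟨fun hz => ?_, fun hz => ?_⟩
      · have := hfix γ hγ (γ⁻¹ • z) (by simpa using Univ.mem_smul_of_mem γ⁻¹ hz)
        rwa [smul_inv_smul] at this
      · have := Univ.mem_smul_of_mem γ (hfix γ⁻¹ (Δ.inv_mem hγ) z hz)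
        rwa [smul_inv_smul] at this
    · obtain ⟨z, -, rfl⟩ := (hxs y).1 hy
      exact z.2
  have hinj : Function.Injective fun y : PermutationModel A F => y.1 := fun _ _ => Subtype.ext
  exact ⟨⟨x, hsymm⟩, isSet_iff_forall_ne.2 hx, fun z => (hxs z.1).trans hinj.mem_set_image⟩

theorem exists_set_of_finite {s : Set (PermutationModel A F)} (hs : s.Finite) :
    ∃ x : PermutationModel A F, IsSet x ∧ ∀ z, mem z x ↔ z ∈ s := by
  have := hs.to_subtype
  have : Small.{u} s := Countable.toSmall s
  refine exists_set s ?_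
  filter_upwards [hs.eventually_all.2 fun x _ => eventually_smul_eq x] with γ hγ x hx
  rwa [hγ x hx]

/-- Membership and atomhood are invariant under the group, hence so is every first-order formula. -/
def smulEquiv (F : SubgroupFilter Γ) (γ : Γ) :
    atomLang.Equiv (PermutationModel A F) (PermutationModel A F) where
  toEquiv := MulAction.toPerm γ
  map_fun' f := Empty.elim f
  map_rel' := fun {_} (r : AtomRel _) x => by
    cases r with
    | isAtom => exact isAtom_smul_iff γ
    | mem => exact mem_smul_smul_iff γ

/-- A class that is definable with parameters is stable under the group elements that fix the
finitely many parameters of its definition. -/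
theorem eventually_smul_mem_of_definable {α : Type*} {s : Set (α → PermutationModel A F)}
    (hs : (Set.univ : Set (PermutationModel A F)).Definable atomLang s) :
    ∀ᶠ γ in F.nhdsOne, ∀ v ∈ s, γ • v ∈ s := by
  obtain ⟨B, -, hB⟩ := Set.definable_iff_finitely_definable.1 hs
  obtain ⟨φ, rfl⟩ := Set.definable_iff_exists_formula_sum.1 hB
  filter_upwards [(Filter.eventually_all_finset B).2 fun x _ => eventually_smul_eq x] with γ hγ v hv
  have h := (FirstOrder.Language.StrongHomClass.realize_formula (smulEquiv F γ) φ).2 hv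
  convert! h using 1
  ext i
  rcases i with b | a
  · exact (hγ b.1 b.2).symm
  · rfl

/-! ### The axioms of ZFA -/

theorem exists_isUnorderedPair (x y : PermutationModel A F) : ∃ z, IsUnorderedPair z x y :=
  exists_set_of_finite (s := {x, y}) (Set.toFinite _)

theorem IsEmptySet.eq {x y : PermutationModel A F} (hx : IsEmptySet x) (hy : IsEmptySet y) :
    x = y :=
  hx.1.ext hy.1 fun z => iff_of_false (hx.2 z) (hy.2 z)

theorem IsSucc.eq {x y z : PermutationModel A F} (hy : IsSucc y x) (hz : IsSucc z x) : y = z :=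
  hy.1.ext hz.1 fun t => by rw [hy.2, hz.2]

theorem exists_isSucc (x : PermutationModel A F) : ∃ y, IsSucc y x := by
  have := small_setOf_mem x
  refine exists_set ({y | mem y x} ∪ {x}) ?_
  filter_upwards [eventually_smul_eq x] with γ hγ y hy
  rcases hy with hy | rfl
  · left
    have := (mem_smul_smul_iff γ).2 hy
    rwa [hγ] at this
  · exact Or.inr hγ

theorem IsEmptySet.smul {x : PermutationModel A F} (hx : IsEmptySet x) (γ : Γ) :
    IsEmptySet (γ • x) :=
  ⟨(isSet_smul_iff γ).2 hx.1, fun _ hy => hx.2 _ ((mem_smul_iff γ).1 hy)⟩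

theorem IsSucc.smul {x y : PermutationModel A F} (hy : IsSucc y x) (γ : Γ) :
    IsSucc (γ • y) (γ • x) :=
  ⟨(isSet_smul_iff γ).2 hy.1, fun z => by
    rw [mem_smul_iff, mem_smul_iff, hy.2, inv_smul_eq_iff]⟩

variable (A F) in
theorem exists_isEmptySet : ∃ x : PermutationModel A F, IsEmptySet x := by
  obtain ⟨x, hx, h⟩ := exists_set_of_finite (A := A) (F := F) (s := ∅) (Set.toFinite _)
  exact ⟨x, hx, fun y => (h y).1⟩

/-- The von Neumann numeral `k`. -/
noncomputable def numeral (A : Type u) [MulAction Γ A] (F : SubgroupFilter Γ) :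
    ℕ → PermutationModel A F
  | 0 => (exists_isEmptySet A F).choose
  | k + 1 => (exists_isSucc (numeral A F k)).choose

theorem isEmptySet_numeral_zero : IsEmptySet (numeral A F 0) := by
  rw [numeral]
  exact (exists_isEmptySet A F).choose_spec

theorem isSucc_numeral (k : ℕ) : IsSucc (numeral A F (k + 1)) (numeral A F k) := by
  rw [numeral]
  exact (exists_isSucc _).choose_spec

theorem smul_numeral (γ : Γ) (k : ℕ) : γ • numeral A F k = numeral A F k := by
  induction k with
  | zero => exact (isEmptySet_numeral_zero.smul γ).eq isEmptySet_numeral_zero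
  | succ k ih =>
    have := (isSucc_numeral (A := A) (F := F) k).smul γ
    rw [ih] at this
    exact this.eq (isSucc_numeral k)

variable (A F) in
/-- The numerals form a set of the model, so that its `ω` is the true one. -/
theorem exists_omega :
    ∃ I : PermutationModel A F, IsInductive I ∧ ∀ x, mem x I ↔ ∃ k, numeral A F k = x := by
  obtain ⟨I, hI, h⟩ := exists_set (Set.range (numeral A F)) <| .of_forall fun γ x hx => by
    obtain ⟨k, rfl⟩ := hx
    exact ⟨k, (smul_numeral γ k).symm⟩
  refine ⟨I, ⟨hI, ⟨_, isEmptySet_numeral_zero, (h _).2 ⟨0, rfl⟩⟩, fun x hx => ?_⟩, h⟩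
  obtain ⟨k, rfl⟩ := (h x).1 hx
  exact ⟨_, isSucc_numeral k, (h _).2 ⟨k + 1, rfl⟩⟩

/-- An internal `∈`-minimal element exists because membership is well-founded externally. -/
theorem exists_mem_minimal {x : PermutationModel A F} (hx : ∃ y, mem y x) :
    ∃ y, mem y x ∧ ∀ z, mem z y → ¬ mem z x := by
  obtain ⟨y, hy, hmin⟩ :=
    (InvImage.wf (fun y : PermutationModel A F => y.1) Univ.mem_wellFounded).has_min
      {y | mem y x} hx
  exact ⟨y, hy, fun z hzy hzx => hmin z hzx hzy⟩

theorem isZFAModel_permutationModel (A : Type u) [MulAction Γ A] (F : SubgroupFilter Γ) :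
    IsZFAModel (PermutationModel A F) where
  atom_no_elements := fun a x ⟨b, hb⟩ h => IsSet.of_mem h ⟨b, hb⟩
  set_of_atoms := by
    have : Small.{u} {x : PermutationModel A F | isAtom x} := by
      refine small_of_injective (β := A) (f := fun x => x.2.choose) fun x y h => ?_
      have h' : x.2.choose = y.2.choose := h
      exact Subtype.ext (Subtype.ext (by rw [x.2.choose_spec, y.2.choose_spec, h']))
    exact exists_set {x | isAtom x} (.of_forall fun γ x hx => (isAtom_smul_iff γ).2 hx)
  extensionality := fun _ _ => IsSet.ext
  pairing := exists_isUnorderedPair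
  union := fun x => by
    have := small_setOf_mem x
    have := fun t : PermutationModel A F => small_setOf_mem t
    have : Small.{u} {z : PermutationModel A F | ∃ t, mem t x ∧ mem z t} := by
      refine small_subset (s := ⋃ t : {t | mem t x}, {z | mem z t.1}) ?_
      rintro z ⟨t, ht, hz⟩
      exact Set.mem_iUnion.2 ⟨⟨t, ht⟩, hz⟩
    refine exists_set {z | ∃ t, mem t x ∧ mem z t} ?_
    filter_upwards [eventually_smul_eq x] with γ hγ z ⟨t, ht, hz⟩
    refine ⟨γ • t, ?_, (mem_smul_smul_iff γ).2 hz⟩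
    rw [← hγ]
    exact (mem_smul_smul_iff γ).2 ht
  powerset := fun x => by
    have := small_setOf_mem x
    have : Small.{u} {z : PermutationModel A F | IsSet z ∧ Subset z x} := by
      refine small_of_injective (β := 𝒫 {y | mem y x})
        (f := fun z => ⟨{y | mem y z.1}, z.2.2⟩) fun z z' h => ?_
      exact Subtype.ext (z.2.1.ext z'.2.1 fun y => Set.ext_iff.1 (congrArg Subtype.val h) y)
    refine exists_set {z | IsSet z ∧ Subset z x} ?_
    filter_upwards [eventually_smul_eq x] with γ hγ z ⟨hz, hzx⟩
    refine ⟨(isSet_smul_iff γ).2 hz, fun y hy => ?_⟩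
    rw [← hγ, mem_smul_iff]
    exact hzx _ ((mem_smul_iff γ).1 hy)
  infinity := (exists_omega A F).imp fun _ h => h.1
  foundation := fun _ => exists_mem_minimal
  separation := fun P hP x => by
    have : Small.{u} {z | mem z x ∧ P z} := small_of_forall_mem fun _ h => h.1
    refine exists_set {z | mem z x ∧ P z} ?_
    filter_upwards [eventually_smul_eq x, eventually_smul_mem_of_definable hP]
      with γ hγ hPγ z ⟨hz, hPz⟩
    refine ⟨?_, hPγ (fun _ => z) hPz⟩
    rw [← hγ]
    exact (mem_smul_smul_iff γ).2 hz
  replacement := fun P hP hfun x => by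
    have := small_setOf_mem x
    have : Small.{u} {z | ∃ t, mem t x ∧ P t z} := by
      refine small_of_injective (β := {t | mem t x})
        (f := fun z => ⟨z.2.choose, z.2.choose_spec.1⟩) fun z z' h => ?_
      have h' : z.2.choose = z'.2.choose := congrArg Subtype.val h
      exact Subtype.ext (hfun _ _ _ z.2.choose_spec.2 (h' ▸ z'.2.choose_spec.2))
    refine exists_set {z | ∃ t, mem t x ∧ P t z} ?_
    filter_upwards [eventually_smul_eq x, eventually_smul_mem_of_definable hP]
      with γ hγ hPγ z ⟨t, ht, hPt⟩
    refine ⟨γ • t, ?_, hPγ ![t, z] hPt⟩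
    rw [← hγ]
    exact (mem_smul_smul_iff γ).2 ht

end Model

/-! ### Pairs, tuples, functions and finite sets inside a permutation model -/

section Coding

variable {A : Type u} {Γ : Type v} [Group Γ] [MulAction Γ A] {F : SubgroupFilter Γ}

theorem IsUnorderedPair.eq {z z' x y : PermutationModel A F} (h : IsUnorderedPair z x y)
    (h' : IsUnorderedPair z' x y) : z = z' :=
  h.1.ext h'.1 fun t => by rw [h.2, h'.2]

theorem IsPair.eq {p q x y : PermutationModel A F} (hp : IsPair p x y) (hq : IsPair q x y) :
    p = q :=
  hp.1.ext hq.1 fun t => by rw [hp.2, hq.2]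

theorem exists_isPair (x y : PermutationModel A F) : ∃ p, IsPair p x y := by
  obtain ⟨a, ha⟩ := exists_isUnorderedPair x x
  obtain ⟨b, hb⟩ := exists_isUnorderedPair x y
  obtain ⟨p, hp, h⟩ := exists_isUnorderedPair a b
  refine ⟨p, hp, fun z => (h z).trans (or_congr ⟨?_, fun hz => hz.eq ha⟩ ⟨?_, fun hz => hz.eq hb⟩)⟩
  · rintro rfl; exact ha
  · rintro rfl; exact hb

theorem IsPair.left_eq {p x y x' y' : PermutationModel A F} (h : IsPair p x y)
    (h' : IsPair p x' y') : x = x' := by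
  obtain ⟨a, ha⟩ := exists_isUnorderedPair x' x'
  rcases (h.2 a).1 ((h'.2 a).2 (Or.inl ha)) with hz | hz <;>
  · have := (ha.2 x).1 ((hz.2 x).2 (Or.inl rfl))
    exact this.elim id id

theorem IsPair.right_mem {p x y x' y' : PermutationModel A F} (h : IsPair p x y)
    (h' : IsPair p x' y') : y = x' ∨ y = y' := by
  obtain ⟨a, ha⟩ := exists_isUnorderedPair x y
  have hy := (ha.2 y).2 (Or.inr rfl)
  rcases (h'.2 a).1 ((h.2 a).2 (Or.inr ha)) with hz | hz
  · exact Or.inl (((hz.2 y).1 hy).elim id id)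
  · exact (hz.2 y).1 hy

theorem IsPair.right_eq {p x y x' y' : PermutationModel A F} (h : IsPair p x y)
    (h' : IsPair p x' y') : y = y' := by
  obtain rfl := h.left_eq h'
  rcases h.right_mem h' with rfl | rfl
  · exact (h'.right_mem h).elim Eq.symm Eq.symm
  · rfl

/-- The Kuratowski pair `(x, y)` of the model. -/
noncomputable def pair (x y : PermutationModel A F) : PermutationModel A F :=
  (exists_isPair x y).choose

theorem isPair_pair (x y : PermutationModel A F) : IsPair (pair x y) x y :=
  (exists_isPair x y).choose_spec

theorem isPair_iff {p x y : PermutationModel A F} : IsPair p x y ↔ p = pair x y :=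
  ⟨fun h => h.eq (isPair_pair x y), fun h => h ▸ isPair_pair x y⟩

theorem pair_inj {x y x' y' : PermutationModel A F} : pair x y = pair x' y' ↔ x = x' ∧ y = y' := by
  constructor
  · intro h
    have h' := isPair_pair x' y'
    rw [← h] at h'
    exact ⟨(isPair_pair x y).left_eq h', (isPair_pair x y).right_eq h'⟩
  · rintro ⟨rfl, rfl⟩; rfl

theorem IsUnorderedPair.smul {z x y : PermutationModel A F} (h : IsUnorderedPair z x y) (γ : Γ) :
    IsUnorderedPair (γ • z) (γ • x) (γ • y) :=
  ⟨(isSet_smul_iff γ).2 h.1, fun t => by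
    rw [mem_smul_iff, h.2, inv_smul_eq_iff, inv_smul_eq_iff]⟩

theorem isUnorderedPair_smul_iff (γ : Γ) {z x y : PermutationModel A F} :
    IsUnorderedPair z (γ • x) (γ • y) ↔ IsUnorderedPair (γ⁻¹ • z) x y :=
  ⟨fun h => by simpa using h.smul γ⁻¹, fun h => by simpa using h.smul γ⟩

theorem smul_pair (γ : Γ) (x y : PermutationModel A F) :
    γ • pair x y = pair (γ • x) (γ • y) := by
  refine isPair_iff.1 ⟨(isSet_smul_iff γ).2 (isPair_pair x y).1, fun t => ?_⟩
  rw [mem_smul_iff, (isPair_pair x y).2, isUnorderedPair_smul_iff, isUnorderedPair_smul_iff]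

theorem related_iff {f a b : PermutationModel A F} : Related f a b ↔ mem (pair a b) f := by
  constructor
  · rintro ⟨p, hp, h⟩
    rwa [← isPair_iff.1 h]
  · exact fun h => ⟨_, h, isPair_pair a b⟩

/-- The element of the model that codes the tuple `v`. -/
noncomputable def tuple : {n : ℕ} → (Fin n → PermutationModel A F) → PermutationModel A F
  | 0, _ => (exists_isEmptySet A F).choose
  | _ + 1, v => pair (v 0) (tuple fun i => v i.succ)

theorem isTuple_iff {n : ℕ} {v : Fin n → PermutationModel A F} {t : PermutationModel A F} :
    IsTuple v t ↔ t = tuple v := by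
  induction n generalizing t with
  | zero =>
    have h := (exists_isEmptySet A F).choose_spec
    exact ⟨fun ht => IsEmptySet.eq ht h, fun ht => by rw [ht]; exact h⟩
  | succ n ih =>
    simp only [IsTuple, ih, exists_eq_left, isPair_iff, tuple]

theorem tuple_injective {n : ℕ} :
    Function.Injective (tuple : (Fin n → PermutationModel A F) → PermutationModel A F) := by
  induction n with
  | zero => exact fun _ _ _ => Subsingleton.elim _ _
  | succ n ih =>
    intro v w h
    obtain ⟨h0, h1⟩ := pair_inj.1 h
    funext i
    exact Fin.cases h0 (congrFun (ih h1)) i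

theorem smul_tuple (γ : Γ) {n : ℕ} (v : Fin n → PermutationModel A F) :
    γ • tuple v = tuple (γ • v) := by
  induction n with
  | zero => exact ((exists_isEmptySet A F).choose_spec.smul γ).eq (exists_isEmptySet A F).choose_spec
  | succ n ih => rw [tuple, smul_pair, ih]; rfl

/-- A map given from outside is a function of the model as soon as it commutes with a subgroup of
the filter. -/
theorem exists_isFunction {x y : PermutationModel A F}
    (f : PermutationModel A F → PermutationModel A F) (hf : ∀ a, mem a x → mem (f a) y)
    (hsymm : ∀ᶠ γ in F.nhdsOne, ∀ a, mem a x → f (γ • a) = γ • f a) :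
    ∃ h, IsFunction h x y ∧ ∀ a b, Related h a b ↔ mem a x ∧ b = f a := by
  have := small_setOf_mem x
  obtain ⟨h, hset, hmem⟩ := exists_set ((fun a => pair a (f a)) '' {a | mem a x}) <| by
    filter_upwards [eventually_smul_eq x, hsymm] with γ hγ hfγ p ⟨a, ha, hp⟩
    refine ⟨γ • a, ?_, ?_⟩
    · rw [← hγ]
      exact (mem_smul_smul_iff γ).2 ha
    · rw [← hp]
      simp only [smul_pair, hfγ a ha]
  have hrel : ∀ a b, Related h a b ↔ mem a x ∧ b = f a := by
    intro a b
    rw [related_iff, hmem]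
    constructor
    · rintro ⟨a', ha', hp⟩
      obtain ⟨rfl, rfl⟩ := pair_inj.1 hp
      exact ⟨ha', rfl⟩
    · rintro ⟨ha, rfl⟩
      exact ⟨a, ha, rfl⟩
  refine ⟨h, ⟨hset, fun p hp => ?_, fun a ha => ⟨f a, (hrel _ _).2 ⟨ha, rfl⟩, fun b hb =>
    ((hrel _ _).1 hb).2⟩⟩, hrel⟩
  obtain ⟨a, ha, rfl⟩ := (hmem p).1 hp
  exact ⟨a, f a, ha, hf a ha, isPair_pair _ _⟩

theorem IsFunction.mem_of_related {f x y a b : PermutationModel A F} (hf : IsFunction f x y)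
    (h : Related f a b) : mem a x ∧ mem b y := by
  obtain ⟨a', b', ha, hb, hp⟩ := hf.2.1 _ (related_iff.1 h)
  obtain ⟨rfl, rfl⟩ := pair_inj.1 (isPair_iff.1 hp)
  exact ⟨ha, hb⟩

theorem not_mem_self (x : PermutationModel A F) : ¬ mem x x := by
  intro h
  obtain ⟨y, hy, hz⟩ := exists_isUnorderedPair x x
  obtain ⟨t, ht, ht'⟩ := exists_mem_minimal ⟨x, (hz x).2 (Or.inl rfl)⟩
  obtain rfl : t = x := ((hz t).1 ht).elim id id
  exact ht' t h ht

theorem mem_numeral_iff {k : ℕ} {z : PermutationModel A F} :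
    mem z (numeral A F k) ↔ ∃ i < k, z = numeral A F i := by
  induction k with
  | zero => simpa using isEmptySet_numeral_zero.2 z
  | succ k ih => simp only [(isSucc_numeral k).2, ih, Nat.exists_lt_succ_right]

theorem numeral_injective : Function.Injective (numeral A F) := by
  intro i j h
  by_contra hij
  rcases lt_or_gt_of_ne hij with hlt | hlt
  · exact not_mem_self _ (h ▸ mem_numeral_iff.2 ⟨i, hlt, rfl⟩)
  · exact not_mem_self _ (h ▸ mem_numeral_iff.2 ⟨j, hlt, rfl⟩)

theorem isNatural_iff {x : PermutationModel A F} : IsNatural x ↔ ∃ k, numeral A F k = x := by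
  constructor
  · intro hx
    obtain ⟨I, hI, h⟩ := exists_omega A F
    exact (h x).1 (hx I hI)
  · rintro ⟨k, rfl⟩ I ⟨-, ⟨z, hz, hzI⟩, hsucc⟩
    induction k with
    | zero => rwa [isEmptySet_numeral_zero.eq hz]
    | succ k ih =>
      obtain ⟨y, hy, hyI⟩ := hsucc _ ih
      rwa [(isSucc_numeral k).eq hy]

/-- Finiteness in the sense of the model is finiteness from outside. -/
theorem isFiniteSet_iff {x : PermutationModel A F} :
    IsFiniteSet x ↔ IsSet x ∧ {y | mem y x}.Finite := by
  refine and_congr_right fun hx => ⟨?_, fun hfin => ?_⟩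
  · rintro ⟨n, f, hn, hf⟩
    obtain ⟨k, rfl⟩ := isNatural_iff.1 hn
    refine (Set.Finite.biUnion (Set.finite_lt_nat k)
      (t := fun i => {a | Related f a (numeral A F i)}) fun i hi => ?_).subset fun a ha => ?_
    · refine Set.Subsingleton.finite fun a ha b hb => ?_
      exact (hf.2 _ (mem_numeral_iff.2 ⟨i, hi, rfl⟩)).unique ha hb
    · obtain ⟨b, hb, -⟩ := hf.1.2.2 a ha
      obtain ⟨i, hi, rfl⟩ := mem_numeral_iff.1 (hf.1.mem_of_related hb).2
      exact Set.mem_biUnion hi hb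
  · classical
    have := hfin.to_subtype
    obtain ⟨k, ⟨e⟩⟩ := Finite.exists_equiv_fin {y | mem y x}
    let g : PermutationModel A F → PermutationModel A F := fun a =>
      if ha : mem a x then numeral A F (e ⟨a, ha⟩) else a
    have hg : ∀ a (ha : mem a x), g a = numeral A F (e ⟨a, ha⟩) := fun a ha => dif_pos ha
    obtain ⟨f, hf, hrel⟩ := exists_isFunction (x := x) (y := numeral A F k) g
      (fun a ha => by rw [hg a ha]; exact mem_numeral_iff.2 ⟨_, (e ⟨a, ha⟩).2, rfl⟩) <| by
        filter_upwards [hfin.eventually_all.2 fun a _ => eventually_smul_eq a] with γ hγ a ha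
        rw [hγ a ha, hg a ha, smul_numeral]
    refine ⟨_, f, isNatural_iff.2 ⟨k, rfl⟩, hf, fun b hb => ?_⟩
    obtain ⟨i, hi, rfl⟩ := mem_numeral_iff.1 hb
    have hmem : mem (e.symm ⟨i, hi⟩).1 x := (e.symm ⟨i, hi⟩).2
    refine ⟨(e.symm ⟨i, hi⟩).1, (hrel _ _).2 ⟨hmem, ?_⟩, fun a ha => ?_⟩
    · rw [hg _ hmem, Subtype.coe_eta, Equiv.apply_symm_apply]
    · obtain ⟨hax, hia⟩ := (hrel _ _).1 ha
      rw [hg a hax] at hia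
      have : e ⟨a, hax⟩ = ⟨i, hi⟩ := Fin.ext (numeral_injective hia).symm
      rw [← this, Equiv.symm_apply_apply]

end Coding

section Structures

variable {A : Type u} {Γ : Type v} [Group Γ] [MulAction Γ A] {F : SubgroupFilter Γ}
  {L : FirstOrder.Language.{w, w'}}

namespace InternalStructure

theorem holds_iff {X : InternalStructure (PermutationModel A F) L} {n : ℕ} {R : L.Relations n}
    {x : Fin n → PermutationModel A F} : X.Holds R x ↔ mem (tuple x) (X.rel R) := by
  simp only [Holds, isTuple_iff, exists_eq_left]

theorem Holds.mem_carrier {X : InternalStructure (PermutationModel A F) L} {n : ℕ}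
    {R : L.Relations n} {x : Fin n → PermutationModel A F} (h : X.Holds R x) (i : Fin n) :
    mem (x i) X.carrier := by
  obtain ⟨y, hy, ht⟩ := X.rel_tuples R _ (holds_iff.1 h)
  rw [tuple_injective (isTuple_iff.1 ht)]
  exact hy i

theorem eventually_holds_smul (X : InternalStructure (PermutationModel A F) L) {n : ℕ}
    (R : L.Relations n) :
    ∀ᶠ γ in F.nhdsOne, ∀ x : Fin n → PermutationModel A F, X.Holds R x → X.Holds R (γ • x) := by
  filter_upwards [eventually_smul_eq (X.rel R)] with γ hγ x hx
  rw [holds_iff] at hx ⊢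
  rwa [← hγ, ← smul_tuple, mem_smul_smul_iff]

end InternalStructure

/-- A structure given from outside on a set of the model is a structure of the model as soon as each
relation is stable under a subgroup of the filter. -/
theorem exists_internalStructure {c : PermutationModel A F} (hc : IsSet c)
    (r : ∀ {n : ℕ}, L.Relations n → Set (Fin n → PermutationModel A F))
    (hr : ∀ {n : ℕ} (R : L.Relations n), ∀ x ∈ r R, ∀ i, mem (x i) c)
    (hsymm : ∀ {n : ℕ} (R : L.Relations n), ∀ᶠ γ in F.nhdsOne, ∀ x ∈ r R, γ • x ∈ r R) :
    ∃ X : InternalStructure (PermutationModel A F) L, X.carrier = c ∧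
      ∀ {n : ℕ} (R : L.Relations n) (x : Fin n → PermutationModel A F), X.Holds R x ↔ x ∈ r R := by
  have hc' := small_setOf_mem c
  have key : ∀ {n : ℕ} (R : L.Relations n), ∃ y : PermutationModel A F, IsSet y ∧
      ∀ t, mem t y ↔ t ∈ tuple '' r R := by
    intro n R
    have : Small.{u} (r R) :=
      small_subset (s := Set.pi Set.univ fun _ : Fin n => {y | mem y c}) fun x hx i _ => hr R x hx i
    refine exists_set (tuple '' r R) ?_
    filter_upwards [hsymm R] with γ hγ t ⟨x, hx, ht⟩
    exact ⟨γ • x, hγ x hx, by rw [← ht, smul_tuple]⟩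
  choose rel hset hmem using @key
  refine ⟨⟨c, hc, rel, hset, fun R t ht => ?_⟩, rfl, fun R x => ?_⟩
  · obtain ⟨x, hx, rfl⟩ := (hmem R t).1 ht
    exact ⟨x, hr R x hx, isTuple_iff.2 rfl⟩
  · rw [InternalStructure.holds_iff]
    exact (hmem R _).trans tuple_injective.mem_set_image

end Structures

/-! ### Compactness and cyclic polymorphisms -/

section Compactness

variable {L : FirstOrder.Language.{v, w}} {C : Type u} {D : Type w'} [L.Structure D]


/-- `h` maps the family of relations `r` on `C` to the relations of `D`. It stands for homomorphisms
into `D` from a set that carries relations but no `L.Structure` instance. -/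
def MapsRel (r : ∀ ⦃n : ℕ⦄, L.Relations n → Set (Fin n → C)) (h : C → D) : Prop :=
  ∀ ⦃n : ℕ⦄ (R : L.Relations n), ∀ x ∈ r R, Structure.RelMap R (h ∘ x)

variable {r : ∀ ⦃n : ℕ⦄, L.Relations n → Set (Fin n → C)}

/-- Averaging: if `σ ^ p = 1`, then `c ↦ φ (h c, h (σ c), …, h (σ ^ (p - 1) c))` is a homomorphism
that is invariant under `σ`, because `φ` is cyclic. It keeps each invariance that `h` already has
under a map that commutes with `σ`. -/
theorem MapsRel.exists_invariant {p : ℕ} {φ : (Fin p → D) → D} (hφ : IsPolymorphism L φ)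
    (hcyc : IsCyclic φ) {σ : C → C} (hσ : σ^[p] = id)
    (hrel : ∀ ⦃n : ℕ⦄ (R : L.Relations n), ∀ x ∈ r R, σ ∘ x ∈ r R) {h : C → D}
    (hh : MapsRel r h) :
    ∃ h' : C → D, MapsRel r h' ∧ h' ∘ σ = h' ∧
      ∀ τ : C → C, Function.Commute σ τ → h ∘ τ = h → h' ∘ τ = h' := by
  have hiter : ∀ (j : ℕ) ⦃n : ℕ⦄ (R : L.Relations n), ∀ x ∈ r R, σ^[j] ∘ x ∈ r R := by
    intro j n R x hx
    induction j with
    | zero => exact hx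
    | succ j ih =>
      rw [Function.iterate_succ']
      exact hrel R _ ih
  refine ⟨fun c => φ fun j => h (σ^[j] c), fun n R x hx => ?_, ?_, fun τ hτ hhτ => ?_⟩
  · exact hφ R (fun i j => h (σ^[j] (x i))) fun j => hh R _ (hiter j R x hx)
  · funext c
    have := hcyc.1
    obtain ⟨q, rfl⟩ : ∃ q, p = q + 1 := ⟨p - 1, by omega⟩
    refine Eq.trans ?_ (hcyc.2 fun j => h (σ^[j] c)).symm
    refine congrArg φ (funext fun j => ?_)
    rw [← Function.iterate_succ_apply]
    rcases Fin.eq_castSucc_or_eq_last j with ⟨i, rfl⟩ | rfl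
    · simp
    · have hc : σ^[q] (σ c) = c := congrFun hσ c
      simp [hc]
  · funext c
    refine congrArg φ (funext fun j => ?_)
    rw [(hτ.iterate_left j).eq]
    exact congrFun hhτ _

/-- The combinatorial core: if `D` has the required cyclic polymorphisms, then a structure all of
whose finite parts map to `D` has a homomorphism to `D` that is invariant under a given family of
commuting automorphisms of finite order. -/
theorem exists_invariant_mapsRel [Finite D] {ι : Type*} (σ : ι → C → C) (p : ι → ℕ)
    (hσ : ∀ i, (σ i)^[p i] = id) (hcomm : ∀ i j, Function.Commute (σ i) (σ j))
    (hrel : ∀ i ⦃n : ℕ⦄ (R : L.Relations n), ∀ x ∈ r R, σ i ∘ x ∈ r R)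
    (hD : ∀ i, ∃ φ : (Fin (p i) → D) → D, IsPolymorphism L φ ∧ IsCyclic φ)
    (hfin : ∀ s : Finset C, ∃ g : s → D, ∀ ⦃n : ℕ⦄ (R : L.Relations n) (x : Fin n → s),
      (fun i => (x i : C)) ∈ r R → Structure.RelMap R (g ∘ x)) :
    ∃ h : C → D, MapsRel r h ∧ ∀ i, h ∘ σ i = h := by
  classical
  have hom : ∃ h : C → D, MapsRel r h := by
    choose g hg using hfin
    obtain ⟨h, hh⟩ := Finset.rado_selection_subtype (α := C) (β := fun _ => D) g
    refine ⟨h, fun n R x hx => ?_⟩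
    obtain ⟨t, hst, ht⟩ := hh (Finset.univ.image x)
    have hxs : ∀ i, x i ∈ Finset.univ.image x := fun i => Finset.mem_image_of_mem x (Finset.mem_univ i)
    have heq : h ∘ x = g t ∘ fun i => ⟨x i, hst (hxs i)⟩ := funext fun i => ht ⟨x i, hxs i⟩
    rw [heq]
    exact hg t R _ hx
  have finite_step : ∀ J : Finset ι, ∃ h : C → D, MapsRel r h ∧ ∀ i ∈ J, h ∘ σ i = h := by
    intro J
    induction J using Finset.induction_on with
    | empty => simpa using hom
    | insert i J _ ih =>
      obtain ⟨h, hh, hJ⟩ := ih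
      obtain ⟨φ, hφ, hcyc⟩ := hD i
      obtain ⟨h', hh', hi, hτ⟩ := hh.exists_invariant hφ hcyc (hσ i) (hrel i)
      refine ⟨h', hh', fun j hj => ?_⟩
      rcases Finset.mem_insert.1 hj with rfl | hj
      · exact hi
      · exact hτ _ (hcomm i j) (hJ j hj)
  -- Compactness for the pairs (point, automorphism): a finite set of points and automorphisms is
  -- treated by a homomorphism that is invariant under these automorphisms.
  obtain ⟨h₀, hh₀⟩ := hom
  rcases isEmpty_or_nonempty C with hC | ⟨⟨c₀⟩⟩
  · exact ⟨h₀, hh₀, fun i => funext fun c => hC.elim c⟩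
  choose g hg hgJ using finite_step
  obtain ⟨χ, hχ⟩ := Finset.rado_selection (α := C ⊕ ι) (β := fun _ => D)
    fun s => Sum.elim (g (s.preimage Sum.inr Sum.inr_injective.injOn)) fun _ => h₀ c₀
  refine ⟨fun c => χ (Sum.inl c), fun n R x hx => ?_, fun i => funext fun c => ?_⟩
  · obtain ⟨t, -, ht⟩ := hχ (Finset.univ.image fun j => Sum.inl (x j))
    have heq : (fun c => χ (Sum.inl c)) ∘ x = g _ ∘ x := funext fun j =>
      ht (Sum.inl (x j)) (Finset.mem_image_of_mem _ (Finset.mem_univ j))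
    rw [heq]
    exact hg _ R x hx
  · obtain ⟨t, hst, ht⟩ := hχ {Sum.inl c, Sum.inl (σ i c), Sum.inr i}
    have h1 := ht (Sum.inl c) (by simp)
    have h2 := ht (Sum.inl (σ i c)) (by simp)
    have hi : i ∈ t.preimage Sum.inr Sum.inr_injective.injOn := by
      rw [Finset.mem_preimage]
      exact hst (by simp)
    simp only [Sum.elim_inl] at h1 h2
    rw [Function.comp_apply, h1, h2]
    exact congrFun (hgJ _ i hi) c

end Compactness

/-! ### Finite instances -/

section Finite

variable {A : Type u} {Γ : Type v} [Group Γ] [MulAction Γ A] {F : SubgroupFilter Γ}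
  {L : FirstOrder.Language.{w, w'}}

namespace InternalStructure

/-- Every finite set of elements of `X`, given from outside, carries a finite substructure of `X`
inside the model. -/
theorem exists_isSubstructure_of_finite (X : InternalStructure (PermutationModel A F) L)
    {s : Set (PermutationModel A F)} (hs : s.Finite) (hsX : ∀ x ∈ s, mem x X.carrier) :
    ∃ Y : InternalStructure (PermutationModel A F) L, Y.IsSubstructure X ∧
      IsFiniteSet Y.carrier ∧ ∀ x, mem x Y.carrier ↔ x ∈ s := by
  obtain ⟨c, hc, hcs⟩ := exists_set_of_finite hs
  obtain ⟨Y, rfl, hY⟩ := exists_internalStructure (L := L) hc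
    (fun {n} R => {x | X.Holds R x ∧ ∀ i, x i ∈ s}) (fun R x hx i => (hcs _).2 (hx.2 i))
    fun {n} R => by
      filter_upwards [hs.eventually_all.2 fun x _ => eventually_smul_eq x] with γ hγ x hx
      have : γ • x = x := funext fun i => hγ _ (hx.2 i)
      rwa [this]
  refine ⟨Y, ⟨fun x hx => hsX x ((hcs x).1 hx), fun R x hx => ?_⟩,
    isFiniteSet_iff.2 ⟨hc, hs.subset fun x hx => (hcs x).1 hx⟩, hcs⟩
  rw [hY]
  exact and_iff_left fun i => (hcs _).1 (hx i)

/-- A homomorphism of the model into a copy of `D` is, from outside, a map into `D`. -/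
theorem IsHom.exists_map {X T : InternalStructure (PermutationModel A F) L}
    {h : PermutationModel A F} (hh : X.IsHom T h) {D : Type*} {e : D → PermutationModel A F}
    (heT : ∀ x, mem x T.carrier ↔ ∃ d, e d = x) :
    ∃ g : {x // mem x X.carrier} → D, ∀ x : {x // mem x X.carrier}, Related h x.1 (e (g x)) := by
  refine Classical.axiom_of_choice 
    (r := fun (x : {x // mem x X.carrier}) d => Related h x.1 (e d)) fun x => ?_
  obtain ⟨b, hb, -⟩ := hh.1.2.2 x x.2
  obtain ⟨d, rfl⟩ := (heT b).1 (hh.1.mem_of_related hb).2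
  exact ⟨d, hb⟩

/-- A map from `X` to a copy of `D`, given from outside, is a homomorphism of the model as soon as
it respects the relations and is invariant under a subgroup of the filter. -/
theorem exists_isHom {X T : InternalStructure (PermutationModel A F) L} {D : Type*} [Finite D]
    [L.Structure D] {e : D → PermutationModel A F} (heT : ∀ x, mem x T.carrier ↔ ∃ d, e d = x)
    (heR : ∀ {n : ℕ} (R : L.Relations n) (d : Fin n → D),
      T.Holds R (fun i => e (d i)) ↔ Structure.RelMap R d)
    (g : {x // mem x X.carrier} → D)
    (hg : ∀ {n : ℕ} (R : L.Relations n) (x : Fin n → {x // mem x X.carrier}),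
      X.Holds R (fun i => x i) → Structure.RelMap R (g ∘ x))
    (hsymm : ∀ᶠ γ in F.nhdsOne, ∀ x y : {x // mem x X.carrier}, y.1 = γ • x.1 → g y = g x) :
    ∃ h, X.IsHom T h := by
  classical
  let f : PermutationModel A F → PermutationModel A F := fun x =>
    if hx : mem x X.carrier then e (g ⟨x, hx⟩) else x
  have hf : ∀ x (hx : mem x X.carrier), f x = e (g ⟨x, hx⟩) := fun x hx => dif_pos hx
  obtain ⟨h, hfun, hrel⟩ := exists_isFunction (x := X.carrier) (y := T.carrier) f
    (fun x hx => by rw [hf x hx]; exact (heT _).2 ⟨_, rfl⟩) <| by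
      filter_upwards [hsymm, eventually_smul_eq X.carrier,
        eventually_all.2 fun d => eventually_smul_eq (e d)] with γ hγ hγX hγD x hx
      have hx' : mem (γ • x) X.carrier := by
        rw [← hγX]
        exact (mem_smul_smul_iff γ).2 hx
      rw [hf _ hx', hf _ hx, hγD, hγ ⟨x, hx⟩ ⟨γ • x, hx'⟩ rfl]
  refine ⟨h, hfun, fun R x y hx hxy => ?_⟩
  have hy : y = fun i => e (g ⟨x i, hx.mem_carrier i⟩) := funext fun i => by
    rw [((hrel _ _).1 (hxy i)).2, hf _ (hx.mem_carrier i)]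
  rw [hy, heR]
  exact hg R (fun i => ⟨x i, hx.mem_carrier i⟩) hx

end InternalStructure

end Finite

/-! ### Cyclic polymorphisms give the compactness principle -/

theorem generator_pow (p : Nat.Primes) : generator p ^ (p : ℕ) = 1 := by
  rw [generator, ← ofAdd_nsmul, ← map_nsmul, nsmul_one, ZMod.natCast_self, map_zero, ofAdd_zero]

theorem eventually_nhdsOne_primeFilter_iff {P : PrimeGroup → Prop} :
    (∀ᶠ γ in primeFilter.nhdsOne, P γ) ↔ ∃ n, ∀ γ ∈ tailSubgroup n, P γ := by
  rw [SubgroupFilter.eventually_iff]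
  constructor
  · rintro ⟨Δ, ⟨n, hn⟩, h⟩
    exact ⟨n, fun γ hγ => h γ (hn hγ)⟩
  · rintro ⟨n, h⟩
    exact ⟨_, ⟨n, le_rfl⟩, h⟩

theorem generator_mem_tailSubgroup {n : ℕ} {p : Nat.Primes} (h : n ≤ p) :
    generator p ∈ tailSubgroup n := Subgroup.subset_closure ⟨p, h, rfl⟩

/-- A map that is invariant under the generators of a tail subgroup is invariant under the whole
subgroup. -/
theorem eq_of_forall_generator {α β : Type*} [MulAction PrimeGroup α] {n : ℕ} {s : Set α}
    (hs : ∀ γ ∈ tailSubgroup n, ∀ x ∈ s, γ • x ∈ s) {g : s → β}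
    (hg : ∀ p : Nat.Primes, n ≤ p → ∀ x y : s, y.1 = generator p • x.1 → g y = g x)
    {γ : PrimeGroup} (hγ : γ ∈ tailSubgroup n) (x y : s) (hxy : y.1 = γ • x.1) : g y = g x := by
  induction hγ using Subgroup.closure_induction generalizing x y with
  | mem γ hγ =>
    obtain ⟨p, hp, rfl⟩ := hγ
    exact hg p hp x y hxy
  | one => exact congrArg g (Subtype.ext (by rw [hxy, one_smul]))
  | mul γ δ _ hδ ihγ ihδ =>
    exact (ihγ ⟨δ • x.1, hs δ hδ x x.2⟩ y (by rw [hxy, mul_smul])).trans (ihδ x _ rfl)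
  | inv γ _ ih => exact (ih y x (by rw [hxy, smul_inv_smul])).symm

theorem holdsK_of_star (L : FirstOrder.Language.{u, v}) [Finite (Σ n, L.Relations n)]
    (D : Type w) [Finite D] [L.Structure D] (hD : Star L D) : HoldsK PrimeModel L D := by
  rintro T ⟨e, he, heT, heR⟩ X hX
  -- A tail subgroup of automorphisms of `X`, all of whose generators have order above `|D|`.
  have hsymm : ∀ᶠ γ in primeFilter.nhdsOne, γ • X.carrier = X.carrier ∧
      ∀ R : Σ n, L.Relations n, ∀ x : Fin R.1 → PrimeModel, X.Holds R.2 x → X.Holds R.2 (γ • x) :=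
    (eventually_smul_eq X.carrier).and (eventually_all.2 fun R => X.eventually_holds_smul R.2)
  obtain ⟨n₀, hn₀⟩ := eventually_nhdsOne_primeFilter_iff.1 hsymm
  obtain ⟨n, hn, hcard⟩ : ∃ n, n₀ ≤ n ∧ Nat.card D < n :=
    ⟨max n₀ (Nat.card D + 1), le_max_left _ _, lt_of_lt_of_le (Nat.lt_succ_self _) (le_max_right _ _)⟩
  replace hn₀ := fun γ (hγ : γ ∈ tailSubgroup n) => hn₀ γ (tailSubgroup_anti hn hγ)
  have hmem : ∀ γ ∈ tailSubgroup n, ∀ x, mem x X.carrier → mem (γ • x) X.carrier := by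
    intro γ hγ x hx
    rw [← (hn₀ γ hγ).1]
    exact (mem_smul_smul_iff γ).2 hx
  let C := {x : PrimeModel // mem x X.carrier}
  let σ : {p : Nat.Primes // n ≤ p} → C → C := fun p x =>
    ⟨generator p.1 • x.1, hmem _ (generator_mem_tailSubgroup p.2) _ x.2⟩
  have hσ : ∀ (p : {p : Nat.Primes // n ≤ p}) (k : ℕ) (x : C),
      ((σ p)^[k] x).1 = generator p.1 ^ k • x.1 := by
    intro p k x
    induction k with
    | zero => rw [pow_zero, one_smul]; rfl
    | succ k ih =>
      rw [Function.iterate_succ_apply', pow_succ', mul_smul, ← ih]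
  have hfin : ∀ s : Finset C, ∃ g : s → D, ∀ ⦃k : ℕ⦄ (R : L.Relations k) (x : Fin k → s),
      X.Holds R (fun i => (x i).1.1) → Structure.RelMap R (g ∘ x) := by
    intro s
    obtain ⟨Y, hYX, hYfin, hYs⟩ := X.exists_isSubstructure_of_finite
      (s.finite_toSet.image Subtype.val) (by rintro _ ⟨x, -, rfl⟩; exact x.2)
    obtain ⟨h, hh⟩ := hX Y hYX hYfin
    obtain ⟨g, hg⟩ := hh.exists_map heT
    have hmemY : ∀ x : s, mem x.1.1 Y.carrier := fun x => (hYs _).2 ⟨x.1, x.2, rfl⟩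
    refine ⟨fun x => g ⟨x.1.1, hmemY x⟩, fun k R x hx => ?_⟩
    rw [← heR]
    refine hh.2 R (fun i => (x i).1.1) _ ?_ fun i => hg ⟨_, hmemY (x i)⟩
    exact (hYX.2 R _ fun i => hmemY (x i)).2 hx
  obtain ⟨g, hg, hgσ⟩ := exists_invariant_mapsRel (L := L) (D := D)
    (r := fun n R => {x : Fin n → C | X.Holds R fun i => (x i).1}) σ (fun p => p.1)
    (fun p => funext fun x => Subtype.ext (by rw [hσ, generator_pow, one_smul]; rfl))
    (fun p q x => Subtype.ext (smul_comm (generator p.1) (generator q.1) x.1))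
    (fun p k R x hx => (hn₀ _ (generator_mem_tailSubgroup p.2)).2 ⟨k, R⟩ _ hx)
    (fun p => hD p.1 p.1.2 (hcard.trans_le p.2)) hfin
  refine InternalStructure.exists_isHom heT heR g (fun R => hg R) ?_
  refine eventually_nhdsOne_primeFilter_iff.2 ⟨n, fun γ hγ x y hxy => ?_⟩
  refine eq_of_forall_generator (s := {x | mem x X.carrier}) hmem (g := g)
    (fun p hp x y hxy => ?_) hγ x y hxy
  have hyx : y = σ ⟨p, hp⟩ x := Subtype.ext hxy
  rw [hyx]
  exact congrFun (hgσ ⟨p, hp⟩) x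

/-! ### Odd cycles without a symmetric colouring -/

theorem Related.smul {A : Type u} {Γ : Type v} [Group Γ] [MulAction Γ A] {F : SubgroupFilter Γ}
    {f a b : PermutationModel A F} (h : Related f a b) (γ : Γ) :
    Related (γ • f) (γ • a) (γ • b) := by
  rw [related_iff] at h ⊢
  rwa [← smul_pair, mem_smul_smul_iff]

/-- A structure `D` given from outside, on elements of the model, is a structure of the model if a
subgroup of the filter acts on it by automorphisms. -/
theorem exists_copy {A : Type u} {Γ : Type v} [Group Γ] [MulAction Γ A] {F : SubgroupFilter Γ}
    {L : FirstOrder.Language.{w, w'}} {D : Type*} [Small.{u} D] [L.Structure D]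
    {e : D → PermutationModel A F} (he : Function.Injective e)
    (hsymm : ∀ᶠ γ in F.nhdsOne, ∃ π : D → D, (∀ d, γ • e d = e (π d)) ∧
      ∀ {n : ℕ} (R : L.Relations n) (d : Fin n → D),
        Structure.RelMap R d → Structure.RelMap R (π ∘ d)) :
    ∃ T : InternalStructure (PermutationModel A F) L, (∀ x, mem x T.carrier ↔ ∃ d, e d = x) ∧
      ∀ {n : ℕ} (R : L.Relations n) (d : Fin n → D),
        T.Holds R (fun i => e (d i)) ↔ Structure.RelMap R d := by
  obtain ⟨c, hc, hce⟩ := exists_set (Set.range e) <| by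
    filter_upwards [hsymm] with γ ⟨π, hπ, _⟩ x ⟨d, hd⟩
    exact ⟨π d, by rw [← hd, hπ]⟩
  obtain ⟨T, rfl, hT⟩ := exists_internalStructure (L := L) hc
    (fun {n} R => (fun (d : Fin n → D) i => e (d i)) '' {d | Structure.RelMap R d})
    (by rintro n R _ ⟨d, -, rfl⟩ i; exact (hce _).2 ⟨d i, rfl⟩) fun {n} R => by
      filter_upwards [hsymm] with γ ⟨π, hπ, hR⟩ x ⟨d, hd, hx⟩
      exact ⟨π ∘ d, hR R d hd, by rw [← hx]; exact funext fun i => (hπ (d i)).symm⟩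
  refine ⟨T, hce, fun {n} R d => (hT R _).trans ?_⟩
  have hinj : Function.Injective fun (d : Fin n → D) i => e (d i) := fun d d' h =>
    funext fun i => he (congrFun h i)
  exact hinj.mem_set_image

theorem generator_smul (p : Nat.Primes) (j : ZMod p) :
    generator p • Cycles.mk p j = ⟨p, j + 1⟩ := by
  change Cycles.mk p (j + DirectSum.of (fun q : Nat.Primes => ZMod q) p 1 p) = _
  rw [DirectSum.of_eq_same]

theorem generator_smul_of_ne {p : Nat.Primes} {y : Cycles} (h : p ≠ y.prime) :
    generator p • y = y := by
  change Cycles.mk y.prime (y.pos + DirectSum.of (fun q : Nat.Primes => ZMod q) p 1 y.prime) = _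
  rw [DirectSum.of_eq_of_ne _ _ _ h.symm, add_zero]

theorem generator_smul_ne (y : Cycles) : generator y.prime • y ≠ y := by
  obtain ⟨p, j⟩ := y
  have : Fact (1 < (p : ℕ)) := ⟨p.2.one_lt⟩
  rw [generator_smul]
  simp

theorem hereditarilySymmetric_atom (y : Cycles) :
    HereditarilySymmetric primeFilter (Univ.atom y) := by
  refine .intro _ ⟨y.prime + 1, ?_⟩ fun x hx => absurd hx (Univ.not_mem_atom x y)
  refine (Subgroup.closure_le _).2 ?_
  rintro _ ⟨p, hp, rfl⟩
  have hne : p ≠ y.prime := by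
    rintro rfl
    exact Nat.not_succ_le_self _ hp
  exact congrArg Univ.atom (generator_smul_of_ne hne)

/-- The atom `y` as an element of the model. -/
def atom (y : Cycles) : PrimeModel := ⟨Univ.atom y, hereditarilySymmetric_atom y⟩

theorem atom_injective : Function.Injective atom := fun _ _ h =>
  Univ.atom_injective (Subtype.mk.inj h)

theorem smul_atom (γ : PrimeGroup) (y : Cycles) : γ • atom y = atom (γ • y) := rfl

/-- The graph on the atoms in which each `y` is joined to its translate by the generator that moves
it: a disjoint union of cycles of length `p`, one for each prime `p`. -/
def cycleGraphs : SimpleGraph Cycles := .fromRel fun y z => z = generator y.prime • y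

theorem cycleGraphs_adj_generator_smul (y : Cycles) :
    cycleGraphs.Adj y (generator y.prime • y) :=
  (SimpleGraph.fromRel_adj _ _ _).2 ⟨(generator_smul_ne y).symm, Or.inl rfl⟩

theorem cycleGraphs_adj_smul (γ : PrimeGroup) {y z : Cycles} (h : cycleGraphs.Adj y z) :
    cycleGraphs.Adj (γ • y) (γ • z) := by
  obtain ⟨hne, h⟩ := (SimpleGraph.fromRel_adj _ _ _).1 h
  refine (SimpleGraph.fromRel_adj _ _ _).2 ⟨(MulAction.injective γ).ne hne, h.imp ?_ ?_⟩
  · rintro rfl; exact smul_comm _ _ _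
  · rintro rfl; exact smul_comm _ _ _

/-- Along each cycle `0, …, p - 1` the colours alternate, except that `p - 1` gets the third one. -/
theorem exists_coloring : Nonempty (cycleGraphs.Coloring (Fin 3)) := by
  let color : Cycles → Fin 3 := fun y =>
    if y.pos.val + 1 = y.prime then 2 else ⟨y.pos.val % 2, by omega⟩
  have hcolor : ∀ y, (color y).val = if y.pos.val + 1 = y.prime then 2 else y.pos.val % 2 :=
    fun y => apply_ite Fin.val _ _ _
  have key : ∀ y : Cycles, color y ≠ color (generator y.prime • y) := by
    rintro ⟨p, j⟩ h
    have hp : 2 ≤ (p : ℕ) := p.2.two_le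
    have : NeZero (p : ℕ) := ⟨p.2.ne_zero⟩
    have : Fact (1 < (p : ℕ)) := ⟨p.2.one_lt⟩
    have hj := ZMod.val_lt j
    have h' := congrArg Fin.val h
    rw [generator_smul, hcolor, hcolor] at h'
    simp only [ZMod.val_add, ZMod.val_one] at h'
    by_cases hjp : j.val + 1 = p
    · rw [if_pos hjp, hjp, Nat.mod_self, if_neg (by omega)] at h'
      omega
    · rw [if_neg hjp, Nat.mod_eq_of_lt (show j.val + 1 < p by omega)] at h'
      split_ifs at h' <;> omega
  refine ⟨SimpleGraph.Coloring.mk color fun {y z} h => ?_⟩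
  rcases ((SimpleGraph.fromRel_adj _ _ _).1 h).2 with rfl | rfl
  · exact key y
  · exact (key z).symm

/-- In the instance made of all cycles, a symmetric homomorphism to `K₃` is constant on the
`p`-cycle for all large `p`. -/
theorem not_holdsK_completeGraphThree :
    ¬ HoldsK PrimeModel FirstOrder.Language.graph (Fin 3) := by
  intro hK
  let _ : FirstOrder.Language.graph.Structure Cycles := cycleGraphs.structure
  -- Any three elements of the model carry a copy of `K₃`; here, three atoms.
  obtain ⟨e, he⟩ : ∃ e : Fin 3 → PrimeModel, Function.Injective e := by
    have : Infinite Cycles := Infinite.of_injective (fun p : Nat.Primes => Cycles.mk p 0)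
      fun _ _ h => (Cycles.mk.inj h).1
    exact ⟨fun i => atom (Infinite.natEmbedding Cycles i), atom_injective.comp
      ((Infinite.natEmbedding Cycles).injective.comp Fin.val_injective)⟩
  obtain ⟨T, heT, heR⟩ := exists_copy (L := FirstOrder.Language.graph) he <| by
    filter_upwards [eventually_all.2 fun d => eventually_smul_eq (e d)] with γ hγ
    exact ⟨id, hγ, fun _ _ h => h⟩
  obtain ⟨X, hXmem, hXR⟩ := exists_copy (L := FirstOrder.Language.graph) (F := primeFilter)
    atom_injective <| .of_forall fun γ => ⟨(γ • ·), smul_atom γ, fun R d hd => by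
      cases R with
      | adj => exact cycleGraphs_adj_smul γ hd⟩
  obtain ⟨h, hh⟩ := hK T ⟨e, he, heT, heR⟩ X fun Y hYX hYfin => by
    obtain ⟨col⟩ := exists_coloring
    choose y hy using fun x : {x // mem x Y.carrier} => (hXmem x.1).1 (hYX.1 _ x.2)
    refine InternalStructure.exists_isHom heT heR (fun x => col (y x)) (fun {n} R x hx => ?_) ?_
    · have hx' := (hYX.2 R _ fun i => (x i).2).1 hx
      have hxy : (fun i => (x i).1) = fun i => atom (y (x i)) := funext fun i => (hy _).symm
      rw [hxy, hXR] at hx'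
      cases R with
      | adj => exact col.valid hx'
    · filter_upwards [(isFiniteSet_iff.1 hYfin).2.eventually_all.2 fun x _ => eventually_smul_eq x]
        with γ hγ x x' hx
      rw [Subtype.ext (hx.trans (hγ x.1 x.2))]
  obtain ⟨n, hn⟩ := eventually_nhdsOne_primeFilter_iff.1 <|
    (eventually_smul_eq h).and (eventually_all.2 fun d => eventually_smul_eq (e d))
  obtain ⟨p, hnp, hp⟩ := Nat.exists_infinite_primes n
  obtain ⟨hγh, hγe⟩ := hn _ (generator_mem_tailSubgroup (p := ⟨p, hp⟩) hnp)
  obtain ⟨g, hg⟩ := hh.exists_map heT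
  let y : Cycles := ⟨⟨p, hp⟩, 0⟩
  let d := g ⟨atom y, (hXmem _).2 ⟨y, rfl⟩⟩
  have h0 : Related h (atom y) (e d) := hg ⟨atom y, (hXmem _).2 ⟨y, rfl⟩⟩
  have h1 : Related h (atom (generator ⟨p, hp⟩ • y)) (e d) := by
    have := h0.smul (generator ⟨p, hp⟩)
    rwa [hγh, hγe] at this
  have hadj : X.Holds FirstOrder.Language.adj
      (fun i => atom (![y, generator ⟨p, hp⟩ • y] i)) :=
    (hXR _ _).2 (cycleGraphs_adj_generator_smul y)
  have := (heR FirstOrder.Language.adj fun _ => d).1 <|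
    hh.2 _ _ _ hadj (by rw [Fin.forall_fin_two]; exact ⟨h0, h1⟩)
  exact (⊤ : SimpleGraph (Fin 3)).irrefl this

end SetsWithAtoms

theorem theorem4p1 :
    SetsWithAtoms.IsZFAModel SetsWithAtoms.PrimeModel ∧
    (∀ (L : FirstOrder.Language.{u, v}) [L.IsRelational] [Finite (Σ n, L.Relations n)]
      (D : Type w) [Finite D] [L.Structure D],
      SetsWithAtoms.Star L D → SetsWithAtoms.HoldsK SetsWithAtoms.PrimeModel L D) ∧
    ¬ SetsWithAtoms.HoldsK SetsWithAtoms.PrimeModel FirstOrder.Language.graph (Fin 3) :=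
  ⟨SetsWithAtoms.isZFAModel_permutationModel _ _,
    fun L _ _ D _ _ hD => SetsWithAtoms.holdsK_of_star L D hD,
    SetsWithAtoms.not_holdsK_completeGraphThree⟩
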